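/- Let $d\ge 1$ and $k\ge 1$ be integers, let $\upsilon,\lambda_b,\lambda_e,\alpha_k,\mu_k,\alpha_e,\mu_e>0$, and put $\delta=d/\upsilon$. The legitimate receivers and the eavesdroppers form two homogeneous Poisson point processes $\Phi_b,\Phi_e$ in $\mathbb{R}^d$ with densities $\lambda_b,\lambda_e$; the transmitter is at the origin. Let $r_k$ be the distance from the origin to the $k$-th nearest point of $\Phi_b$, and $r_e$ the distance from the origin to the nearest point of $\Phi_e$. For $i\in\{k,e\}$ put $$\Omega_i=\frac{\Gamma(\mu_i)}{\Gamma(\mu_i+2/\alpha_i)},\qquad \epsilon_i=\frac{1}{\Omega_i\Gamma(\mu_i)},\qquad \theta_i=\frac1{\Omega_i},$$ and let the channel gain $g_i$ be a random variable with density $$f_{g_i}(x)=\frac{\alpha_i x^{\alpha_i\mu_i/2-1}}{2\,\Omega_i^{\alpha_i\mu_i/2}\,\Gamma(\mu_i)}\exp\!\Big(-\Big(\frac{x}{\Omega_i}\Big)^{\alpha_i/2}\Big),\qquad x>0.$$ Assume that $\Phi_b,\Phi_e,g_k,g_e$ are independent. Let $\eta_k=p/\sigma_k^2$ and $\eta_e=p/\sigma_e^2$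 with $p,\sigma_k,\sigma_e>0$, $\varpi=\eta_k/\eta_e$, $A_k=\pi\lambda_b$ and $A_e=\pi\lambda_e$. Then the probability of non-zero secrecy capacity of the $k$-th nearest legitimate receiver in the presence of the nearest eavesdropper, $$\mathcal P_{nz,NN}=\Pr\!\left(\frac{\eta_k g_k}{r_k^{\upsilon}}>\frac{\eta_e g_e}{r_e^{\upsilon}}\right),$$ satisfies $$\mathcal P_{nz,NN}=1-\frac{\epsilon_k\epsilon_e}{\theta_k\theta_e\Gamma(k)}\,H^{3,2}_{3,3}\!\left[\frac{\theta_e\varpi}{\theta_k}\Big(\frac{A_k}{A_e}\Big)^{1/\delta}\,\middle|\,\begin{matrix}(1-\mu_k,\frac{2}{\alpha_k}),\,(0,\frac1\delta),\,(1,1)\\(0,1),\,(\mu_e,\frac{2}{\alpha_e}),\,(k,\frac1\delta)\end{matrix}\right],$$ and the $H$-function on the right-hand side exists. Here Fox's $H$-function is $$H^{m,n}_{p,q}\!\left[z\,\middle|\,\begin{matrix}(a_1,A_1),\dots,(a_p,A_p)\\(b_1,B_1),\dots,(b_q,B_q)\end{matrix}\right]=\frac1{2\pi i}\int_{c-i\infty}^{c+i\infty}\frac{\prod_{j=1}^m\Gamma(b_j+B_js)\prod_{j=1}^n\Gamma(1-a_j-A_js)}{\prod_{j=m+1}^q\Gamma(1-b_j-B_js)\prod_{j=n+1}^p\Gamma(a_j+A_js)}\,z^{-s}\,ds,$$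 where the line $\operatorname{Re}s=c$ has the poles of all $\Gamma(b_j+B_js)$, $j\le m$, on its left and those of all $\Gamma(1-a_j-A_js)$, $j\le n$, on its right; existence means that such a line exists and that the integral converges absolutely along every such line, with the same value. -/

import Mathlib

open MeasureTheory ProbabilityTheory

/-! ### Fox's `H`-function

Parameters are given by two lists of pairs: `a` is the upper list `(a₁, A₁), …, (a_p, A_p)` and `b` is
the lower list `(b₁, B₁), …, (b_q, B_q)`, with complex `a_j`, `b_j` and positive real `A_j`, `B_j`. -/

/-- The quotient of Gamma functions
`∏_{j ≤ m} Γ(b_j + B_j s) ∏_{j ≤ n} Γ(1 - a_j - A_j s)` over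
`∏_{j > m} Γ(1 - b_j - B_j s) ∏_{j > n} Γ(a_j + A_j s)`.
(Mathlib's `Γ` is `0` at its poles, so that `1 / Γ` is `0` there, as it should be.) -/
noncomputable def foxKernel (m n : ℕ) (a b : List (ℂ × ℝ)) (s : ℂ) : ℂ :=
  (((b.take m).map fun p => Complex.Gamma (p.1 + p.2 * s)).prod *
      ((a.take n).map fun p => Complex.Gamma (1 - p.1 - p.2 * s)).prod) /
    (((b.drop m).map fun p => Complex.Gamma (1 - p.1 - p.2 * s)).prod *
      ((a.drop n).map fun p => Complex.Gamma (p.1 + p.2 * s)).prod)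

/-- The vertical line `Re s = c` separates the poles `-(b_j + ν) / B_j` of the `Γ(b_j + B_j s)`,
`j ≤ m`, which have to lie on its left, from the poles `(1 - a_j + ν) / A_j` of the
`Γ(1 - a_j - A_j s)`, `j ≤ n`, which have to lie on its right. -/
def FoxSeparates (m n : ℕ) (a b : List (ℂ × ℝ)) (c : ℝ) : Prop :=
  (∀ p ∈ b.take m, ∀ ν : ℕ, -(p.1.re + ν) / p.2 < c) ∧
    (∀ p ∈ a.take n, ∀ ν : ℕ, c < (1 - p.1.re + ν) / p.2)

/-- The integrand `Θ(s) z ^ (-s)` of the Mellin–Barnes integral at the point `s = c + i t`. -/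
noncomputable def foxIntegrand (m n : ℕ) (a b : List (ℂ × ℝ)) (z : ℂ) (c t : ℝ) : ℂ :=
  foxKernel m n a b (c + t * Complex.I) * z ^ (-((c : ℂ) + t * Complex.I))

/-- `H^{m,n}_{p,q}[z | a; b]` exists and has the value `w`: some vertical line separates the two
families of poles, and along every such line the Mellin–Barnes integral
`(1 / 2πi) ∫_{c - i∞}^{c + i∞} Θ(s) z ^ (-s) ds` converges absolutely and equals `w`. -/
def HasFoxH (m n : ℕ) (a b : List (ℂ × ℝ)) (z w : ℂ) : Prop :=
  (∃ c : ℝ, FoxSeparates m n a b c) ∧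
    ∀ c : ℝ, FoxSeparates m n a b c →
      Integrable (foxIntegrand m n a b z c) ∧
        (1 / (2 * (Real.pi : ℂ))) * ∫ t : ℝ, foxIntegrand m n a b z c t = w

/-- The Fox function `H^{m,n}_{p,q}[z | a; b]` is well defined (with a straight contour). -/
def FoxHExists (m n : ℕ) (a b : List (ℂ × ℝ)) (z : ℂ) : Prop :=
  ∃ w : ℂ, HasFoxH m n a b z w

open scoped Classical in
/-- The Fox function `H^{m,n}_{p,q}[z | a; b]` (with the junk value `0` if it does not exist). -/
noncomputable def foxH (m n : ℕ) (a b : List (ℂ × ℝ)) (z : ℂ) : ℂ :=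
  if h : FoxHExists m n a b z then h.choose else 0

theorem HasFoxH.unique {m n : ℕ} {a b : List (ℂ × ℝ)} {z w w' : ℂ}
    (h : HasFoxH m n a b z w) (h' : HasFoxH m n a b z w') : w = w' := by
  obtain ⟨c, hc⟩ := h.1
  exact (h.2 c hc).2.symm.trans (h'.2 c hc).2

theorem HasFoxH.foxH_eq {m n : ℕ} {a b : List (ℂ × ℝ)} {z w : ℂ}
    (h : HasFoxH m n a b z w) : foxH m n a b z = w := by
  have hex : FoxHExists m n a b z := ⟨w, h⟩
  unfold foxH
  rw [dif_pos hex]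
  exact hex.choose_spec.unique h

/-! ### Homogeneous Poisson point processes in `ℝ^d` -/

/-- The number of points of the random set `Φ` in the set `B`. -/
noncomputable def pointCount {Ω : Type*} {d : ℕ} (Φ : Ω → Set (EuclideanSpace ℝ (Fin d)))
    (B : Set (EuclideanSpace ℝ (Fin d))) (ω : Ω) : ℕ∞ :=
  (Φ ω ∩ B).encard

/-- `Φ` is a homogeneous Poisson point process in `ℝ^d` with density `lam`: a random locally finite
set whose number of points in a Borel set `B` of finite volume is Poisson distributed with
mean `lam * vol B`, and whose numbers of points in pairwise disjoint Borel sets are independent. -/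
structure IsHPPP {Ω : Type*} [MeasurableSpace Ω] (P : Measure Ω) {d : ℕ} (lam : ℝ)
    (Φ : Ω → Set (EuclideanSpace ℝ (Fin d))) : Prop where
  locallyFinite : ∀ ω, ∀ R : ℝ, (Φ ω ∩ Metric.closedBall 0 R).Finite
  measurable_count : ∀ B, MeasurableSet B → Measurable (pointCount Φ B)
  count_law : ∀ B, MeasurableSet B → volume B ≠ ⊤ → ∀ j : ℕ,
    P {ω | pointCount Φ B ω = j} =
      ENNReal.ofReal
        (Real.exp (-(lam * volume.real B)) * (lam * volume.real B) ^ j / j.factorial)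
  count_indep : ∀ (N : ℕ) (B : Fin N → Set (EuclideanSpace ℝ (Fin d))),
    (∀ i, MeasurableSet (B i)) → Pairwise (fun i j => Disjoint (B i) (B j)) →
      iIndepFun (fun i => pointCount Φ (B i)) P

/-- The σ-algebra generated by the point process `Φ`, i.e. by all its counting variables. -/
noncomputable abbrev sigmaPoints {Ω : Type*} {d : ℕ} (Φ : Ω → Set (EuclideanSpace ℝ (Fin d))) :
    MeasurableSpace Ω :=
  ⨆ (B : Set (EuclideanSpace ℝ (Fin d))) (_ : MeasurableSet B),
    MeasurableSpace.comap (pointCount Φ B) inferInstance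

/-- The distance from the origin to the `k`-th nearest point of `S` (`k ≥ 1`): the least `r ≥ 0`
such that at least `k` points of `S` have distance at most `r` from the origin. -/
noncomputable def kthDist {d : ℕ} (S : Set (EuclideanSpace ℝ (Fin d))) (k : ℕ) : ℝ :=
  sInf {r : ℝ | 0 ≤ r ∧ (k : ℕ∞) ≤ (S ∩ Metric.closedBall 0 r).encard}

/-! ### The channel gain and the signal-to-noise ratio -/

/-- `Ω_i = Γ(μ_i) / Γ(μ_i + 2 / α_i)`. -/
noncomputable def gainScale (α μ : ℝ) : ℝ := Real.Gamma μ / Real.Gamma (μ + 2 / α)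

/-- `ε_i = 1 / (Ω_i Γ(μ_i))`. -/
noncomputable def gainEps (α μ : ℝ) : ℝ := 1 / (gainScale α μ * Real.Gamma μ)

/-- `θ_i = 1 / Ω_i`. -/
noncomputable def gainTheta (α μ : ℝ) : ℝ := 1 / gainScale α μ

/-- The density of the channel gain under `α`-`μ` fading. -/
noncomputable def gainPDF (α μ x : ℝ) : ℝ :=
  if 0 < x then
    α * x ^ (α * μ / 2 - 1) / (2 * gainScale α μ ^ (α * μ / 2) * Real.Gamma μ) *
      Real.exp (-((x / gainScale α μ) ^ (α / 2)))
  else 0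

/-- The law of the channel gain under `α`-`μ` fading. -/
noncomputable def gainLaw (α μ : ℝ) : Measure ℝ :=
  volume.withDensity fun x => ENNReal.ofReal (gainPDF α μ x)

/-- `η = p / σ²` for the transmission power `p` and the noise parameter `σ`. -/
noncomputable def snrScale (p σ : ℝ) : ℝ := p / σ ^ 2

/-- The received signal-to-noise ratio `η g / r ^ υ`. -/
noncomputable def snr (η g r υ : ℝ) : ℝ := η * (g / r ^ υ)

/-- The probability of non-zero secrecy capacity of the `k`-th nearest legitimate receiver against the
nearest eavesdropper: the probability that the legitimate SNR exceeds the eavesdropper's. -/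
noncomputable def pnzNN {Ω : Type*} [MeasurableSpace Ω] (P : Measure Ω) {d : ℕ}
    (Φb Φe : Ω → Set (EuclideanSpace ℝ (Fin d))) (gk ge : Ω → ℝ) (ηk ηe υ : ℝ) (k : ℕ) : ℝ :=
  P.real {ω | snr ηe (ge ω) (kthDist (Φe ω) 1) υ < snr ηk (gk ω) (kthDist (Φb ω) k) υ}

/-! ### The parameters of the closed form -/

/-- The upper list `(1 - μ_k, 2 / α_k), (0, 1 / δ), (1, 1)`. -/
noncomputable def upperNN (αk μk δ : ℝ) : List (ℂ × ℝ) :=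
  [(((1 - μk : ℝ) : ℂ), 2 / αk), (0, 1 / δ), (1, 1)]

/-- The lower list `(0, 1), (μ_e, 2 / α_e), (k, 1 / δ)`. -/
noncomputable def lowerNN (αe μe δ : ℝ) (k : ℕ) : List (ℂ × ℝ) :=
  [(0, 1), ((μe : ℂ), 2 / αe), ((k : ℂ), 1 / δ)]

/-- The argument `(θ_e ϖ / θ_k) (A_k / A_e) ^ (1 / δ)`, where `A_k = π λ_b` and `A_e = π λ_e`. -/
noncomputable def argNN (αk μk αe μe ϖ lamb lame δ : ℝ) : ℝ :=
  gainTheta αe μe * ϖ / gainTheta αk μk *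
    ((Real.pi * lamb) / (Real.pi * lame)) ^ (1 / δ)

/-!
Let `Y` be the quotient of `g_e / r_e ^ υ` by `g_k / r_k ^ υ`, each gain and each distance being divided
by its scale. The scales and `ϖ` combine to the argument `z` of the Fox function, so that the secrecy
capacity is non-zero if and only if `Y < z`.

The two gains and the two distances all follow generalized Gamma distributions. For the gains this is
their density (`gainLaw_eq_generalizedGamma`). For the distances it holds because the `k`-th nearest
point is farther away than `r` if and only if the ball of radius `r` contains fewer than `k` points,
which is a Poisson probability (`IsHPPP.map_kthDist`). A generalized Gamma variable has complex moments
`Γ(m + s / q) / Γ(m)` (`generalizedGamma_moment`), so by independence the moment `E[Y ^ s]` is a product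
of four Gamma functions divided by a constant. The volume of the unit ball enters both distances and
cancels in `z`, which is why `A_k / A_e` may be formed with `π` in every dimension.

The Mellin transform of the tail `x ↦ P(Y > x)` is `E[Y ^ s] / s` (`hasMellin_measureReal_Ioi`), and
`1 / s = Γ(s) / Γ(1 + s)` supplies the remaining two factors of the kernel. The tail is continuous since
`Y` has no atoms, and `E[Y ^ s] / s` is integrable on vertical lines since it decays like `1 / t ^ 2`
(`integrable_Gamma_prod_div`). Hence Mellin inversion along any separating line expresses `P(Y > z)` as
the Fox function (`measureReal_Ioi_eq_integral`), and the probability sought is `1 - P(Y > z)`.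
-/

/-! ### The Mellin transform of a tail function -/

theorem integrableOn_cpow_sub_one_Ioo {s : ℂ} (hs : 0 < s.re) {y : ℝ} (hy : 0 < y) :
    IntegrableOn (fun x : ℝ => (x : ℂ) ^ (s - 1)) (Set.Ioo 0 y) := by
  have h := intervalIntegral.intervalIntegrable_cpow' (a := 0) (b := y) (r := s - 1) (by simpa using hs)
  exact ((intervalIntegrable_iff_integrableOn_Ioc_of_le hy.le).1 h).mono_set Set.Ioo_subset_Ioc_self

theorem integral_cpow_sub_one_Ioo {s : ℂ} (hs : 0 < s.re) {y : ℝ} (hy : 0 < y) :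
    ∫ x in Set.Ioo 0 y, (x : ℂ) ^ (s - 1) = (y : ℂ) ^ s / s := by
  have hs0 : s ≠ 0 := fun h => by simp [h] at hs
  rw [← integral_Ioc_eq_integral_Ioo, ← intervalIntegral.integral_of_le hy.le,
    integral_cpow (Or.inl (by simpa using hs))]
  simp [hs0]

theorem integral_rpow_sub_one_Ioo {c : ℝ} (hc : 0 < c) {y : ℝ} (hy : 0 < y) :
    ∫ x in Set.Ioo 0 y, x ^ (c - 1) = y ^ c / c := by
  rw [← integral_Ioc_eq_integral_Ioo, ← intervalIntegral.integral_of_le hy.le,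
    integral_rpow (Or.inl (by linarith))]
  simp [hc.ne', Real.zero_rpow]

/-- For a probability measure on `(0, ∞)` with `s`-th moment `m`, the Mellin transform of the tail
`x ↦ μ (x, ∞)` at `s` is `m / s`: exchange the integrals in `∫ x ^ (s - 1) ∫ 1_{x < y} dμ(y) dx`. -/
theorem hasMellin_measureReal_Ioi {μ : Measure ℝ} [IsProbabilityMeasure μ]
    (hpos : ∀ᵐ y ∂μ, 0 < y) {s : ℂ} (hs : 0 < s.re)
    (hint : Integrable (fun y : ℝ => (y : ℂ) ^ s) μ) :
    HasMellin (fun x => (μ.real (Set.Ioi x) : ℂ)) s ((∫ y, (y : ℂ) ^ s ∂μ) / s) := by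
  set F : ℝ × ℝ → ℂ := {p : ℝ × ℝ | p.1 < p.2}.indicator fun p => (p.1 : ℂ) ^ (s - 1) with hF
  have hFm : Measurable F :=
    Measurable.indicator (by fun_prop) (measurableSet_lt measurable_fst measurable_snd)
  have hFy (y : ℝ) : (fun x => F (x, y)) =
      (Set.Iio y).indicator fun x : ℝ => (x : ℂ) ^ (s - 1) := by
    ext x; simp [hF, Set.indicator_apply]
  have hFx (x : ℝ) : (fun y => F (x, y)) =
      (Set.Ioi x).indicator fun _ => (x : ℂ) ^ (s - 1) := by
    ext y; simp [hF, Set.indicator_apply]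
  have hinter (y : ℝ) : Set.Iio y ∩ Set.Ioi 0 = Set.Ioo 0 y := by
    ext x; simp [and_comm]
  have hFint : Integrable F ((volume.restrict (Set.Ioi 0)).prod μ) := by
    refine (integrable_prod_iff' hFm.aestronglyMeasurable).2 ⟨?_, ?_⟩
    · filter_upwards [hpos] with y hy
      rw [hFy, integrable_indicator_iff measurableSet_Iio, IntegrableOn,
        Measure.restrict_restrict measurableSet_Iio, hinter]
      exact integrableOn_cpow_sub_one_Ioo hs hy
    · refine (hint.norm.div_const s.re).congr ?_
      filter_upwards [hpos] with y hy
      have h1 : (fun x => ‖F (x, y)‖) =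
          (Set.Iio y).indicator fun x : ℝ => ‖(x : ℂ) ^ (s - 1)‖ := by
        ext x; rw [show F (x, y) = (fun x => F (x, y)) x from rfl, hFy, norm_indicator_eq_indicator_norm]
      rw [h1, integral_indicator measurableSet_Iio, Measure.restrict_restrict measurableSet_Iio,
        hinter, Complex.norm_cpow_eq_rpow_re_of_pos hy, ← integral_rpow_sub_one_Ioo hs hy]
      refine setIntegral_congr_fun measurableSet_Ioo fun x hx => ?_
      simp [Complex.norm_cpow_eq_rpow_re_of_pos hx.1]
  have hval (x : ℝ) : ∫ y, F (x, y) ∂μ = (x : ℂ) ^ (s - 1) • (μ.real (Set.Ioi x) : ℂ) := by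
    rw [hFx, integral_indicator measurableSet_Ioi, setIntegral_const, smul_eq_mul, mul_comm]
    simp
  refine ⟨?_, ?_⟩
  · have := hFint.integral_prod_left
    simp_rw [hval] at this
    exact this
  · have := integral_integral_swap (f := fun x y => F (x, y)) hFint
    simp_rw [hval] at this
    rw [mellin, this, ← integral_div]
    refine integral_congr_ae ?_
    filter_upwards [hpos] with y hy
    rw [hFy, integral_indicator measurableSet_Iio, Measure.restrict_restrict measurableSet_Iio,
      hinter, integral_cpow_sub_one_Ioo hs hy]

theorem continuousAt_measureReal_Ioi {μ : Measure ℝ} [IsProbabilityMeasure μ] {x : ℝ}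
    (hx : μ {x} = 0) : ContinuousAt (fun x => (μ.real (Set.Ioi x) : ℂ)) x := by
  have hc : ContinuousAt (cdf μ) x := by
    rw [(monotone_cdf μ).continuousAt_iff_leftLim_eq_rightLim, StieltjesFunction.rightLim_eq]
    have h := (cdf μ).measure_singleton x
    rw [measure_cdf, hx, eq_comm, ENNReal.ofReal_eq_zero] at h
    exact le_antisymm ((monotone_cdf μ).leftLim_le le_rfl) (by linarith)
  have h : (fun x => (μ.real (Set.Ioi x) : ℂ)) = fun x => ((1 - cdf μ x : ℝ) : ℂ) := by
    ext y
    rw [cdf_eq_real, ← Set.compl_Iic, probReal_compl_eq_one_sub measurableSet_Iic]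
  rw [h]
  exact Complex.continuous_ofReal.continuousAt.comp (continuousAt_const.sub hc)

/-- A probability measure on `(0, ∞)` whose moments on the line `Re s = c` are given by `M` has the
tail `μ (x, ∞) = (1 / 2πi) ∫ M(s) x ^ (-s) ds / s` at every `x` that is not an atom. -/
theorem measureReal_Ioi_eq_integral {μ : Measure ℝ} [IsProbabilityMeasure μ]
    (hpos : ∀ᵐ y ∂μ, 0 < y) {c : ℝ} (hc : 0 < c) {x : ℝ} (hx : 0 < x) (hx0 : μ {x} = 0)
    {M : ℂ → ℂ}
    (hM : ∀ s : ℂ, s.re = c → Integrable (fun y : ℝ => (y : ℂ) ^ s) μ ∧ ∫ y, (y : ℂ) ^ s ∂μ = M s)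
    (hint : Integrable fun t : ℝ => M (c + t * Complex.I) / (c + t * Complex.I)) :
    (1 / (2 * (Real.pi : ℂ))) * ∫ t : ℝ, M (c + t * Complex.I) / (c + t * Complex.I) *
      (x : ℂ) ^ (-((c : ℂ) + t * Complex.I)) = μ.real (Set.Ioi x) := by
  have hmel (s : ℂ) (hs : s.re = c) :
      HasMellin (fun x => (μ.real (Set.Ioi x) : ℂ)) s (M s / s) := by
    rw [← (hM s hs).2]
    exact hasMellin_measureReal_Ioi hpos (hs ▸ hc) (hM s hs).1
  have hre (t : ℝ) : ((c : ℂ) + t * Complex.I).re = c := by simp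
  have h := mellinInv_mellin_eq c (fun x => (μ.real (Set.Ioi x) : ℂ)) hx
    (hmel c (by simp)).1
    (by
      rw [Complex.VerticalIntegrable]
      simpa only [(hmel _ (hre _)).2] using hint) (continuousAt_measureReal_Ioi hx0)
  rw [← h, mellinInv]
  simp_rw [(hmel _ (hre _)).2]
  rw [Complex.real_smul]
  simp [mul_comm]

/-! ### Growth of the Gamma function on vertical lines -/

theorem Complex.norm_Gamma_le_Gamma_re {s : ℂ} (hs : 0 < s.re) :
    ‖Complex.Gamma s‖ ≤ Real.Gamma s.re := by
  rw [Complex.Gamma_eq_integral hs, Complex.GammaIntegral, Real.Gamma_eq_integral hs]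
  refine (norm_integral_le_integral_norm _).trans_eq ?_
  refine setIntegral_congr_fun measurableSet_Ioi fun x hx => ?_
  simp [Complex.norm_cpow_eq_rpow_re_of_pos hx, Complex.norm_exp]

/-- One application of `Γ(s + 1) = s Γ(s)` gives decay of order `1 / |Im s|` on vertical lines. -/
theorem Complex.abs_im_mul_norm_Gamma_le {s : ℂ} (hs : 0 < s.re) :
    |s.im| * ‖Complex.Gamma s‖ ≤ Real.Gamma (s.re + 1) := by
  have hs0 : s ≠ 0 := fun h => by simp [h] at hs
  calc |s.im| * ‖Complex.Gamma s‖ ≤ ‖s‖ * ‖Complex.Gamma s‖ := by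
        gcongr; exact Complex.abs_im_le_norm s
    _ = ‖Complex.Gamma (s + 1)‖ := by rw [Complex.Gamma_add_one s hs0, norm_mul]
    _ ≤ Real.Gamma (s.re + 1) := by
        simpa using Complex.norm_Gamma_le_Gamma_re (s := s + 1) (by simp; linarith)

theorem continuous_Gamma_comp_vertical {a : ℂ} {B c : ℝ} (h : 0 < a.re + B * c) :
    Continuous fun t : ℝ => Complex.Gamma (a + B * (c + t * Complex.I)) := by
  refine continuous_iff_continuousAt.2 fun t => ?_
  refine ContinuousAt.comp (g := Complex.Gamma) ?_ (by fun_prop)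
  refine (Complex.differentiableAt_Gamma _ fun m hm => ?_).continuousAt
  have := congrArg Complex.re hm
  simp at this
  have : (0:ℝ) ≤ m := m.cast_nonneg
  linarith

/-! ### The generalized Gamma distribution -/

/-- The generalized Gamma distribution with shape `m`, scale `b` and power `q`, that is, the law of
`b * U ^ (1 / q)` where `U` is Gamma distributed with shape `m` and rate `1`. -/
noncomputable def generalizedGamma (q b m : ℝ) : Measure ℝ :=
  volume.withDensity fun x => ENNReal.ofReal
    (if 0 < x then q * x ^ (q * m - 1) / (b ^ (q * m) * Real.Gamma m) * Real.exp (-(x / b) ^ q)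
      else 0)

theorem gainLaw_eq_generalizedGamma (α μ : ℝ) :
    gainLaw α μ = generalizedGamma (α / 2) (gainScale α μ) μ := by
  unfold gainLaw generalizedGamma gainPDF
  congr 1
  ext x
  congr 1
  split_ifs
  · rw [show α / 2 * μ = α * μ / 2 by ring]
    congr 1
    ring
  · rfl

theorem generalizedGamma_absolutelyContinuous (q b m : ℝ) : generalizedGamma q b m ≪ volume :=
  withDensity_absolutelyContinuous _ _

theorem ae_generalizedGamma_pos (q b m : ℝ) : ∀ᵐ x ∂generalizedGamma q b m, 0 < x := by
  rw [ae_iff]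
  have : {x : ℝ | ¬ 0 < x} = Set.Iic 0 := by ext; simp
  rw [this, generalizedGamma, withDensity_apply _ measurableSet_Iic,
    setLIntegral_congr_fun (g := fun _ => 0) measurableSet_Iic]
  · simp
  · intro x hx
    simp [not_lt.2 (Set.mem_Iic.1 hx)]

theorem hasMellin_exp_neg_div_rpow {q b : ℝ} (hq : 0 < q) (hb : 0 < b) {w : ℂ} (hw : 0 < w.re) :
    HasMellin (fun x : ℝ => (Real.exp (-(x / b) ^ q) : ℂ)) w
      ((b : ℂ) ^ w / q * Complex.Gamma (w / q)) := by
  have hwq : 0 < (w / q).re := by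
    rw [Complex.div_ofReal_re]; positivity
  set E : ℝ → ℂ := fun x => (Real.exp (-x) : ℂ)
  have h0 : MellinConvergent E (w / q) := by
    have := Complex.GammaIntegral_convergent hwq
    refine IntegrableOn.congr_fun this (fun x _ => ?_) measurableSet_Ioi
    simp [E, mul_comm]
  have h0' : mellin E (w / q) = Complex.Gamma (w / q) := by
    rw [Complex.Gamma_eq_integral hwq, Complex.GammaIntegral_eq_mellin]
  have hf : (fun x : ℝ => (Real.exp (-(x / b) ^ q) : ℂ)) =
      fun x : ℝ => (fun y : ℝ => E (y ^ q)) (b⁻¹ * x) := by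
    ext x; simp [E, div_eq_inv_mul]
  rw [hf]
  refine ⟨?_, ?_⟩
  · rw [MellinConvergent.comp_mul_left (f := fun y : ℝ => E (y ^ q)) (inv_pos.2 hb),
      MellinConvergent.comp_rpow hq.ne']
    exact h0
  · rw [mellin_comp_mul_left (fun y : ℝ => E (y ^ q)) w (inv_pos.2 hb), mellin_comp_rpow, h0', abs_of_pos hq,
      Complex.ofReal_inv, Complex.inv_cpow, Complex.cpow_neg, inv_inv, Complex.real_smul, smul_eq_mul]
    · push_cast; ring
    · rw [Complex.arg_ofReal_of_nonneg hb.le]; exact Real.pi_pos.ne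

/-- The `s`-th moment of the generalized Gamma distribution, with the scale divided out, is
`Γ(m + s / q) / Γ(m)`. -/
theorem generalizedGamma_moment {q b m : ℝ} (hq : 0 < q) (hb : 0 < b) (hm : 0 < m) {s : ℂ}
    (hs : 0 < q * m + s.re) :
    Integrable (fun x : ℝ => ((x / b : ℝ) : ℂ) ^ s) (generalizedGamma q b m) ∧
      ∫ x : ℝ, ((x / b : ℝ) : ℂ) ^ s ∂generalizedGamma q b m =
        Complex.Gamma (m + s / q) / Complex.Gamma m := by
  have hG : 0 < Real.Gamma m := Real.Gamma_pos_of_pos hm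
  set C : ℝ := q / (b ^ (q * m) * Real.Gamma m) with hC
  have hC0 : 0 < C := by positivity
  set w : ℂ := s + (q * m : ℝ) with hw
  have hwre : 0 < w.re := by simp [hw]; linarith
  have hM := hasMellin_exp_neg_div_rpow hq hb hwre
  set D : ℝ → ℝ := fun x => if 0 < x then
    q * x ^ (q * m - 1) / (b ^ (q * m) * Real.Gamma m) * Real.exp (-(x / b) ^ q) else 0 with hD
  have hDm : Measurable D := by
    refine Measurable.ite measurableSet_Ioi ?_ measurable_const
    fun_prop
  have hD0 (x : ℝ) : 0 ≤ D x := by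
    simp only [hD]; split_ifs <;> positivity
  have hbs : (b : ℂ) ^ s ≠ 0 := by
    rw [Complex.cpow_ne_zero_iff]; left; exact_mod_cast hb.ne'
  have hpt (x : ℝ) : D x • ((x / b : ℝ) : ℂ) ^ s = (Set.Ioi 0).indicator
      (fun x : ℝ => (C / (b : ℂ) ^ s) * ((x : ℂ) ^ (w - 1) • (Real.exp (-(x / b) ^ q) : ℂ))) x := by
    by_cases hx : 0 < x
    · rw [Set.indicator_of_mem (Set.mem_Ioi.2 hx)]
      have h1 : ((x / b : ℝ) : ℂ) ^ s = (x : ℂ) ^ s / (b : ℂ) ^ s := by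
        rw [eq_div_iff hbs, ← Complex.mul_cpow_ofReal_nonneg (by positivity) hb.le]
        congr 1
        rw [← Complex.ofReal_mul, div_mul_cancel₀ _ hb.ne']
      have h2 : (x : ℂ) ^ (w - 1) = (x : ℂ) ^ s * ((x ^ (q * m - 1) : ℝ) : ℂ) := by
        rw [Complex.ofReal_cpow hx.le, ← Complex.cpow_add _ _ (by exact_mod_cast hx.ne')]
        congr 1
        simp [hw]; ring
      rw [h1, h2, Complex.real_smul]
      simp only [hD, if_pos hx, hC, smul_eq_mul]
      push_cast
      ring
    · rw [Set.indicator_of_notMem (by simpa using hx)]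
      simp [hD, hx]
  have hν : generalizedGamma q b m = volume.withDensity fun x => ENNReal.ofReal (D x) := rfl
  rw [hν]
  refine ⟨?_, ?_⟩
  · rw [integrable_withDensity_iff_integrable_smul' (by fun_prop) (by simp)]
    simp_rw [ENNReal.toReal_ofReal (hD0 _), hpt]
    rw [integrable_indicator_iff measurableSet_Ioi]
    exact hM.1.const_mul _
  · rw [integral_withDensity_eq_integral_toReal_smul (by fun_prop) (by simp)]
    simp_rw [ENNReal.toReal_ofReal (hD0 _), hpt]
    rw [integral_indicator measurableSet_Ioi, integral_const_mul]
    have := hM.2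
    rw [mellin] at this
    rw [this]
    have h3 : (b : ℂ) ^ w = (b : ℂ) ^ s * ((b ^ (q * m) : ℝ) : ℂ) := by
      rw [Complex.ofReal_cpow hb.le, ← Complex.cpow_add _ _ (by exact_mod_cast hb.ne')]
    have h4 : w / q = m + s / q := by
      have : (q : ℂ) ≠ 0 := by exact_mod_cast hq.ne'
      simp only [hw]; push_cast; field_simp; ring
    have h5 : ((b ^ (q * m) : ℝ) : ℂ) ≠ 0 := by
      exact_mod_cast (by positivity : b ^ (q * m) ≠ 0)
    have h6 : Complex.Gamma m ≠ 0 := by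
      rw [Complex.Gamma_ofReal]; exact_mod_cast hG.ne'
    have h7 : (q : ℂ) ≠ 0 := by exact_mod_cast hq.ne'
    rw [h3, h4, hC, Complex.ofReal_div, Complex.ofReal_mul, ← Complex.Gamma_ofReal]
    field_simp

/-! ### Absolute convergence of the Mellin–Barnes integral -/

theorem norm_Gamma_vertical_le {a B c : ℝ} (h : 0 < a + B * c) (t : ℝ) :
    ‖Complex.Gamma (a + B * (c + t * Complex.I))‖ ≤ Real.Gamma (a + B * c) := by
  have hre : ((a : ℂ) + B * (c + t * Complex.I)).re = a + B * c := by simp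
  have := Complex.norm_Gamma_le_Gamma_re (s := (a : ℂ) + B * (c + t * Complex.I)) (by rwa [hre])
  rwa [hre] at this

theorem abs_mul_norm_Gamma_vertical_le {a B c : ℝ} (h : 0 < a + B * c) (t : ℝ) :
    |B * t| * ‖Complex.Gamma (a + B * (c + t * Complex.I))‖ ≤ Real.Gamma (a + B * c + 1) := by
  have hre : ((a : ℂ) + B * (c + t * Complex.I)).re = a + B * c := by simp
  have him : ((a : ℂ) + B * (c + t * Complex.I)).im = B * t := by simp
  have := Complex.abs_im_mul_norm_Gamma_le (s := (a : ℂ) + B * (c + t * Complex.I)) (by rwa [hre])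
  rwa [hre, him] at this

/-- Absolute convergence of the Mellin–Barnes integral: the factor `1 / s` and one of the Gamma
functions each contribute decay of order `1 / |t|`, and the other factors are bounded. -/
theorem integrable_Gamma_prod_div {a₁ a₂ a₃ a₄ B₁ B₂ B₃ B₄ c : ℝ} (hc : 0 < c)
    (h₁ : 0 < a₁ + B₁ * c) (h₂ : 0 < a₂ + B₂ * c) (h₃ : 0 < a₃ + B₃ * c) (h₄ : 0 < a₄ + B₄ * c)
    (hB₄ : B₄ ≠ 0) :
    Integrable fun t : ℝ =>
      Complex.Gamma (a₁ + B₁ * (c + t * Complex.I)) * Complex.Gamma (a₂ + B₂ * (c + t * Complex.I)) *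
        Complex.Gamma (a₃ + B₃ * (c + t * Complex.I)) *
        Complex.Gamma (a₄ + B₄ * (c + t * Complex.I)) / (c + t * Complex.I) := by
  set G₁ := Real.Gamma (a₁ + B₁ * c)
  set G₂ := Real.Gamma (a₂ + B₂ * c)
  set G₃ := Real.Gamma (a₃ + B₃ * c)
  set G₄ := Real.Gamma (a₄ + B₄ * c)
  set G₅ := Real.Gamma (a₄ + B₄ * c + 1)
  have hre (t : ℝ) : ((c : ℂ) + t * Complex.I).re = c := by simp
  have him (t : ℝ) : ((c : ℂ) + t * Complex.I).im = t := by simp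
  have hne (t : ℝ) : (c : ℂ) + t * Complex.I ≠ 0 := fun h => by
    have := congrArg Complex.re h
    rw [hre] at this
    exact hc.ne' this
  refine ((integrable_inv_one_add_sq.const_mul
    (G₁ * G₂ * G₃ * (G₄ / c + G₅ / |B₄|)))).mono' ?_ (Filter.Eventually.of_forall fun t => ?_)
  · refine Continuous.aestronglyMeasurable (Continuous.div ?_ (by fun_prop) hne)
    exact (((continuous_Gamma_comp_vertical (by simpa using h₁)).mul
      (continuous_Gamma_comp_vertical (by simpa using h₂))).mul
      (continuous_Gamma_comp_vertical (by simpa using h₃))).mul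
      (continuous_Gamma_comp_vertical (by simpa using h₄))
  · rw [← div_eq_mul_inv, le_div_iff₀ (by positivity), norm_div, norm_mul, norm_mul, norm_mul]
    have e₁ := norm_Gamma_vertical_le h₁ t
    have e₂ := norm_Gamma_vertical_le h₂ t
    have e₃ := norm_Gamma_vertical_le h₃ t
    have e₄ := norm_Gamma_vertical_le h₄ t
    have e₅ := abs_mul_norm_Gamma_vertical_le h₄ t
    set N := ‖(c : ℂ) + t * Complex.I‖
    have hN : c ≤ N := (hre t).symm.le.trans ((le_abs_self _).trans (Complex.abs_re_le_norm _))
    have hN' : |t| ≤ N := by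
      have := Complex.abs_im_le_norm ((c : ℂ) + t * Complex.I)
      rwa [him] at this
    have hN0 : 0 < N := hc.trans_le hN
    have hg₁ : 0 < G₁ := Real.Gamma_pos_of_pos h₁
    have hg₂ : 0 < G₂ := Real.Gamma_pos_of_pos h₂
    have hg₃ : 0 < G₃ := Real.Gamma_pos_of_pos h₃
    have hg₅ : 0 < G₅ := Real.Gamma_pos_of_pos (by linarith)
    set n := ‖Complex.Gamma (a₄ + B₄ * (c + t * Complex.I))‖ with hn
    have hB : 0 < |B₄| := abs_pos.2 hB₄
    have key : n / N * (1 + t ^ 2) ≤ G₄ / c + G₅ / |B₄| := by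
      have k1 : n / N ≤ G₄ / c := div_le_div₀ ((norm_nonneg _).trans e₄) e₄ hc hN
      have k2 : n / N * t ^ 2 ≤ G₅ / |B₄| := by
        rw [le_div_iff₀ hB, div_mul_eq_mul_div, div_mul_eq_mul_div, div_le_iff₀ hN0]
        calc n * t ^ 2 * |B₄| = |B₄ * t| * n * |t| := by
              rw [abs_mul, ← sq_abs t]; ring
          _ ≤ G₅ * N := mul_le_mul e₅ hN' (abs_nonneg _) hg₅.le
      linarith
    calc _ = ‖Complex.Gamma (a₁ + B₁ * (c + t * Complex.I))‖ *
          ‖Complex.Gamma (a₂ + B₂ * (c + t * Complex.I))‖ *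
          ‖Complex.Gamma (a₃ + B₃ * (c + t * Complex.I))‖ * (n / N * (1 + t ^ 2)) := by ring
      _ ≤ G₁ * G₂ * G₃ * (G₄ / c + G₅ / |B₄|) := by gcongr

/-! ### Distances to the points of a Poisson process -/

theorem kthDist_nonneg {d : ℕ} (S : Set (EuclideanSpace ℝ (Fin d))) (k : ℕ) : 0 ≤ kthDist S k :=
  Real.sInf_nonneg fun _ hr => hr.1

/-- The second alternative is the case of fewer than `k` points, where `kthDist` is the infimum of the
empty set, which is `0` by convention. Local finiteness ensures that the infimum is attained
otherwise. -/
theorem kthDist_le_iff {d : ℕ} {S : Set (EuclideanSpace ℝ (Fin d))}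
    (hS : ∀ R : ℝ, (S ∩ Metric.closedBall 0 R).Finite) (k : ℕ) {r : ℝ} (hr : 0 ≤ r) :
    kthDist S k ≤ r ↔ (k : ℕ∞) ≤ (S ∩ Metric.closedBall 0 r).encard ∨
      ∀ n : ℕ, (S ∩ Metric.closedBall 0 (n : ℝ)).encard < k := by
  have hmono {r r' : ℝ} (h : r ≤ r') :
      (S ∩ Metric.closedBall 0 r).encard ≤ (S ∩ Metric.closedBall 0 r').encard :=
    Set.encard_le_encard (Set.inter_subset_inter_right _ (Metric.closedBall_subset_closedBall h))
  have hbdd : BddBelow {r : ℝ | 0 ≤ r ∧ (k : ℕ∞) ≤ (S ∩ Metric.closedBall 0 r).encard} :=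
    ⟨0, fun _ h => h.1⟩
  constructor
  · intro h
    by_contra! hcon
    obtain ⟨hlt, n, hn⟩ := hcon
    -- finitely many points lie in the unit shell beyond radius `r`, so they keep a distance to it
    obtain ⟨ε, hε, hεS⟩ : ∃ ε > 0, ∀ x ∈ S, ‖x‖ ≤ r + ε → ‖x‖ ≤ r := by
      have hfin : ((fun x : EuclideanSpace ℝ (Fin d) => ‖x‖) ''
          (S ∩ Metric.closedBall 0 (r + 1)) \ Set.Iic r).Finite := ((hS (r + 1)).image _).sdiff
      obtain ⟨ε, hε, hball⟩ := Metric.isOpen_iff.1 hfin.isClosed.isOpen_compl r (by simp)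
      refine ⟨min (ε / 2) 1, by positivity, fun x hx hxr => ?_⟩
      by_contra! hxr'
      have h1 : ‖x‖ ∈ Metric.ball r ε := by
        rw [Metric.mem_ball, Real.dist_eq, abs_of_pos (by linarith)]
        linarith [min_le_left (ε / 2) 1]
      refine hball h1 ⟨⟨x, ⟨hx, ?_⟩, rfl⟩, by simpa using hxr'⟩
      rw [mem_closedBall_zero_iff]
      linarith [min_le_right (ε / 2) 1]
    have : r + ε ≤ kthDist S k := by
      refine le_csInf ⟨n, by positivity, hn⟩ fun r' hr' => ?_
      by_contra! hlt'
      refine (hr'.2.trans (Set.encard_le_encard fun x hx => ?_)).not_gt hlt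
      refine ⟨hx.1, mem_closedBall_zero_iff.2 (hεS x hx.1 ?_)⟩
      exact (mem_closedBall_zero_iff.1 hx.2).trans hlt'.le
    linarith
  · rintro (h | h)
    · exact csInf_le hbdd ⟨hr, h⟩
    · have : {r : ℝ | 0 ≤ r ∧ (k : ℕ∞) ≤ (S ∩ Metric.closedBall 0 r).encard} = ∅ := by
        refine Set.eq_empty_of_forall_notMem fun r' hr' => ?_
        obtain ⟨n, hn⟩ := exists_nat_ge r'
        exact (hr'.2.trans (hmono hn)).not_gt (h n)
      rw [kthDist, this, Real.sInf_empty]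
      exact hr

theorem measurable_kthDist {Ω : Type*} {d : ℕ} {Φ : Ω → Set (EuclideanSpace ℝ (Fin d))}
    (hΦ : ∀ ω, ∀ R : ℝ, (Φ ω ∩ Metric.closedBall 0 R).Finite) (k : ℕ) :
    Measurable[sigmaPoints Φ] fun ω => kthDist (Φ ω) k := by
  have hcount (r : ℝ) : Measurable[sigmaPoints Φ] (pointCount Φ (Metric.closedBall 0 r)) := by
    refine (comap_measurable (pointCount Φ (Metric.closedBall 0 r))).mono ?_ le_rfl
    exact le_iSup₂_of_le (Metric.closedBall 0 r) Metric.isClosed_closedBall.measurableSet le_rfl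
  let _ : MeasurableSpace Ω := sigmaPoints Φ
  refine measurable_of_Iic fun r => ?_
  rcases lt_or_ge r 0 with hr | hr
  · have : (fun ω => kthDist (Φ ω) k) ⁻¹' Set.Iic r = ∅ :=
      Set.eq_empty_of_forall_notMem fun ω hω =>
        ((kthDist_nonneg (Φ ω) k).trans hω).not_gt hr
    rw [this]
    exact @MeasurableSet.empty _ (sigmaPoints Φ)
  · have : (fun ω => kthDist (Φ ω) k) ⁻¹' Set.Iic r =
        pointCount Φ (Metric.closedBall 0 r) ⁻¹' Set.Ici (k : ℕ∞) ∪
          ⋂ n : ℕ, pointCount Φ (Metric.closedBall 0 (n : ℝ)) ⁻¹' Set.Iio (k : ℕ∞) := by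
      ext ω
      simp [kthDist_le_iff (hΦ ω) k hr, pointCount]
    rw [this]
    exact MeasurableSet.union (hcount r MeasurableSet.of_discrete)
      (MeasurableSet.iInter fun n => hcount n MeasurableSet.of_discrete)

/-- The probability that a Poisson variable with mean `u` is less than `k`. -/
noncomputable def poissonTail (k : ℕ) (u : ℝ) : ℝ :=
  ∑ j ∈ Finset.range k, Real.exp (-u) * u ^ j / j.factorial

theorem poissonTail_zero {k : ℕ} (hk : 1 ≤ k) : poissonTail k 0 = 1 := by
  obtain ⟨n, rfl⟩ := Nat.exists_eq_add_of_le' hk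
  simp [poissonTail, Finset.sum_range_succ']

theorem hasDerivAt_poissonTail (n : ℕ) (u : ℝ) :
    HasDerivAt (poissonTail (n + 1)) (-(Real.exp (-u) * u ^ n / n.factorial)) u := by
  induction n with
  | zero =>
    have : poissonTail 1 = fun u => Real.exp (-u) := by ext; simp [poissonTail]
    simpa [this] using (hasDerivAt_neg u).exp
  | succ n ih =>
    have h : poissonTail (n + 2) = fun u => poissonTail (n + 1) u +
        Real.exp (-u) * u ^ (n + 1) / (n + 1).factorial := by
      ext u; rw [poissonTail, Finset.sum_range_succ]; rfl
    rw [h]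
    refine (ih.add (((hasDerivAt_neg u).exp.mul (hasDerivAt_pow (n + 1) u)).div_const
      ((n + 1).factorial : ℝ))).congr_deriv ?_
    rw [Nat.factorial_succ]
    push_cast
    have : (n.factorial : ℝ) ≠ 0 := by positivity
    have : (n : ℝ) + 1 ≠ 0 := by positivity
    field_simp
    ring

theorem tendsto_poissonTail (k : ℕ) :
    Filter.Tendsto (poissonTail k) Filter.atTop (nhds 0) := by
  rw [← Finset.sum_const_zero (s := Finset.range k)]
  refine tendsto_finsetSum _ fun j _ => ?_
  have := (Real.tendsto_pow_mul_exp_neg_atTop_nhds_zero j).div_const (j.factorial : ℝ)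
  simpa [mul_comm] using this

/-- For integer shape and power the tail of the generalized Gamma distribution is a Poisson
probability, because `-poissonTail k ((x / b) ^ d)` is a primitive of the density. -/
theorem generalizedGamma_Ioi {d k : ℕ} (hd : 1 ≤ d) (hk : 1 ≤ k) {b : ℝ} (hb : 0 < b) {r : ℝ}
    (hr : 0 ≤ r) :
    generalizedGamma d b k (Set.Ioi r) = ENNReal.ofReal (poissonTail k ((r / b) ^ d)) := by
  obtain ⟨n, rfl⟩ := Nat.exists_eq_add_of_le' hk
  obtain ⟨e, rfl⟩ := Nat.exists_eq_add_of_le' hd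
  set D : ℝ → ℝ := fun x => ((e + 1 : ℕ) : ℝ) * x ^ (((e + 1 : ℕ) : ℝ) * ((n + 1 : ℕ) : ℝ) - 1) /
    (b ^ (((e + 1 : ℕ) : ℝ) * ((n + 1 : ℕ) : ℝ)) * Real.Gamma ((n + 1 : ℕ) : ℝ)) *
      Real.exp (-(x / b) ^ ((e + 1 : ℕ) : ℝ)) with hD
  have hG : Real.Gamma ((n + 1 : ℕ) : ℝ) = n.factorial := by
    push_cast; exact Real.Gamma_nat_eq_factorial n
  have hD0 (x : ℝ) (hx : x ∈ Set.Ioi r) : 0 ≤ D x := by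
    have : 0 < x := hr.trans_lt hx
    simp only [hD, hG]
    positivity
  have hderiv (x : ℝ) (hx : x ∈ Set.Ioi r) :
      HasDerivAt (fun x => -poissonTail (n + 1) ((x / b) ^ (e + 1))) (D x) x := by
    have hx0 : 0 < x := hr.trans_lt hx
    refine ((hasDerivAt_poissonTail n ((x / b) ^ (e + 1))).comp x
      (((hasDerivAt_id x).div_const b).pow (e + 1))).neg.congr_deriv ?_
    have e1 : x ^ (((e + 1 : ℕ) : ℝ) * ((n + 1 : ℕ) : ℝ) - 1) = x ^ ((e + 1) * n + e) := by
      rw [← Real.rpow_natCast]; congr 1; push_cast; ring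
    have e2 : b ^ (((e + 1 : ℕ) : ℝ) * ((n + 1 : ℕ) : ℝ)) = b ^ ((e + 1) * n + e + 1) := by
      rw [← Real.rpow_natCast]; congr 1; push_cast; ring
    simp only [hD, hG, e1, e2, Real.rpow_natCast, id, Nat.add_sub_cancel]
    rw [← pow_mul, div_pow x b ((e + 1) * n), div_pow x b e]
    have : (n.factorial : ℝ) ≠ 0 := by positivity
    field_simp
    ring
  have hcont : ContinuousWithinAt (fun x => -poissonTail (n + 1) ((x / b) ^ (e + 1)))
      (Set.Ici r) r := by
    have : Continuous (poissonTail (n + 1)) := by unfold poissonTail; fun_prop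
    exact Continuous.continuousWithinAt (by fun_prop)
  have hlim : Filter.Tendsto (fun x => -poissonTail (n + 1) ((x / b) ^ (e + 1))) Filter.atTop
      (nhds (-0)) :=
    ((tendsto_poissonTail (n + 1)).comp ((Filter.tendsto_pow_atTop (by simp)).comp
      (Filter.tendsto_id.atTop_div_const hb))).neg
  rw [generalizedGamma, withDensity_apply _ measurableSet_Ioi,
    setLIntegral_congr_fun (g := fun x => ENNReal.ofReal (D x)) measurableSet_Ioi,
    ← ofReal_integral_eq_lintegral_ofReal,
    integral_Ioi_of_hasDerivAt_of_nonneg hcont hderiv hD0 hlim]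
  · simp
  · exact integrableOn_Ioi_deriv_of_nonneg hcont hderiv hD0 hlim
  · exact (ae_restrict_iff' measurableSet_Ioi).2 (Filter.Eventually.of_forall hD0)
  · intro x hx
    have hx0 : 0 < x := hr.trans_lt hx
    simp only [if_pos hx0, hD]

section Poisson

variable {Ω : Type*} [MeasurableSpace Ω] {P : Measure Ω} {d : ℕ} {lam : ℝ}
  {Φ : Ω → Set (EuclideanSpace ℝ (Fin d))}

theorem IsHPPP.sigmaPoints_le (h : IsHPPP P lam Φ) : sigmaPoints Φ ≤ ‹MeasurableSpace Ω› :=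
  iSup₂_le fun B hB => (h.measurable_count B hB).comap_le

theorem IsHPPP.measurable_kthDist (h : IsHPPP P lam Φ) (k : ℕ) :
    Measurable fun ω => kthDist (Φ ω) k :=
  (_root_.measurable_kthDist h.locallyFinite k).mono h.sigmaPoints_le le_rfl

theorem IsHPPP.measure_pointCount_lt (h : IsHPPP P lam Φ) (hlam : 0 < lam) (k : ℕ)
    {B : Set (EuclideanSpace ℝ (Fin d))} (hB : MeasurableSet B) (hB' : volume B ≠ ⊤) :
    P {ω | pointCount Φ B ω < k} = ENNReal.ofReal (poissonTail k (lam * volume.real B)) := by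
  have hset : {ω | pointCount Φ B ω < k} =
      ⋃ j ∈ Finset.range k, {ω | pointCount Φ B ω = (j : ℕ)} := by
    ext ω
    simp only [Set.mem_ofPred_eq, Set.mem_iUnion, Finset.mem_range, exists_prop]
    constructor
    · intro hlt
      obtain ⟨j, hj⟩ := ENat.ne_top_iff_exists.1 hlt.ne_top
      rw [← hj] at hlt ⊢
      exact ⟨j, by exact_mod_cast hlt, rfl⟩
    · rintro ⟨j, hj, e⟩
      rw [e]; exact_mod_cast hj
  rw [hset, measure_biUnion_finset, poissonTail, ENNReal.ofReal_sum_of_nonneg]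
  · exact Finset.sum_congr rfl fun j _ => h.count_law B hB hB' j
  · intro j _; positivity
  · intro i _ j _ hij
    refine Set.disjoint_left.2 fun ω hi hj => hij ?_
    simp only [Set.mem_ofPred_eq] at hi hj
    exact_mod_cast hi.symm.trans hj
  · intro j _
    exact h.measurable_count B hB (measurableSet_singleton _)

/-- The scale of the distances to the points of a homogeneous Poisson process in `ℝ^d` with density
`lam`: the radius of a ball which contains one point on average. -/
noncomputable def poissonRadius (d : ℕ) (lam : ℝ) : ℝ :=
  (lam * volume.real (Metric.ball (0 : EuclideanSpace ℝ (Fin d)) 1)) ^ (-(1 / (d : ℝ)))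

theorem volume_real_unitBall_pos (d : ℕ) :
    0 < volume.real (Metric.ball (0 : EuclideanSpace ℝ (Fin d)) 1) :=
  ENNReal.toReal_pos (Metric.measure_ball_pos _ _ one_pos).ne' measure_ball_lt_top.ne

theorem poissonRadius_pos (d : ℕ) {lam : ℝ} (hlam : 0 < lam) : 0 < poissonRadius d lam :=
  Real.rpow_pos_of_pos (mul_pos hlam (volume_real_unitBall_pos d)) _

theorem mul_volume_closedBall_eq {d : ℕ} (hd : 1 ≤ d) {lam : ℝ} (hlam : 0 < lam) {r : ℝ}
    (hr : 0 ≤ r) :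
    lam * volume.real (Metric.closedBall (0 : EuclideanSpace ℝ (Fin d)) r) =
      (r / poissonRadius d lam) ^ d := by
  have hV := volume_real_unitBall_pos d
  have h1 : volume.real (Metric.closedBall (0 : EuclideanSpace ℝ (Fin d)) r) =
      r ^ d * volume.real (Metric.ball (0 : EuclideanSpace ℝ (Fin d)) 1) := by
    rw [measureReal_def, Measure.addHaar_closedBall _ _ hr, ENNReal.toReal_mul,
      ENNReal.toReal_ofReal (by positivity), finrank_euclideanSpace_fin, measureReal_def]
  have hd0 : (d : ℝ) ≠ 0 := by positivity
  rw [h1, div_pow, poissonRadius, ← Real.rpow_natCast (_ ^ _), ← Real.rpow_mul (by positivity),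
    neg_mul, one_div_mul_cancel hd0, Real.rpow_neg_one, div_inv_eq_mul]
  ring

theorem IsHPPP.ae_exists_le_pointCount (h : IsHPPP P lam Φ) (hd : 1 ≤ d) (hlam : 0 < lam) (k : ℕ) :
    ∀ᵐ ω ∂P, ∃ n : ℕ, (k : ℕ∞) ≤ (Φ ω ∩ Metric.closedBall 0 (n : ℝ)).encard := by
  rw [ae_iff]
  have hlim : Filter.Tendsto (fun n : ℕ =>
      ENNReal.ofReal (poissonTail k (((n : ℝ) / poissonRadius d lam) ^ d))) Filter.atTop (nhds 0) := by
    rw [← ENNReal.ofReal_zero]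
    refine (ENNReal.continuous_ofReal.tendsto 0).comp ((tendsto_poissonTail k).comp ?_)
    exact (Filter.tendsto_pow_atTop (by omega)).comp
      (tendsto_natCast_atTop_atTop.atTop_div_const (poissonRadius_pos d hlam))
  refine le_antisymm (ge_of_tendsto' hlim fun n => ?_) zero_le
  rw [← mul_volume_closedBall_eq hd hlam n.cast_nonneg, ← h.measure_pointCount_lt hlam k
    Metric.isClosed_closedBall.measurableSet measure_closedBall_lt_top.ne]
  refine measure_mono fun ω hω => ?_
  simp only [not_exists, not_le, Set.mem_ofPred_eq] at hω
  exact hω n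

/-- The distance to the `k`-th nearest point has a generalized Gamma distribution: it exceeds `r`
if and only if the closed ball of radius `r` contains fewer than `k` points. -/
theorem IsHPPP.map_kthDist [IsProbabilityMeasure P] (h : IsHPPP P lam Φ) (hd : 1 ≤ d)
    (hlam : 0 < lam) {k : ℕ} (hk : 1 ≤ k) :
    P.map (fun ω => kthDist (Φ ω) k) = generalizedGamma d (poissonRadius d lam) k := by
  have hm := h.measurable_kthDist k
  have hb := poissonRadius_pos d hlam
  have hd0 : d ≠ 0 := by omega
  have hIoi {r : ℝ} (hr : 0 ≤ r) : P.map (fun ω => kthDist (Φ ω) k) (Set.Ioi r) =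
      generalizedGamma d (poissonRadius d lam) k (Set.Ioi r) := by
    rw [generalizedGamma_Ioi hd hk hb hr, ← mul_volume_closedBall_eq hd hlam hr,
      ← h.measure_pointCount_lt hlam k Metric.isClosed_closedBall.measurableSet
        measure_closedBall_lt_top.ne, Measure.map_apply hm measurableSet_Ioi]
    refine measure_congr ?_
    filter_upwards [h.ae_exists_le_pointCount hd hlam k] with ω hω
    obtain ⟨n, hn⟩ := hω
    have := kthDist_le_iff (h.locallyFinite ω) k hr
    rw [or_iff_left (fun hcon => (hcon n).not_ge hn)] at this
    rw [eq_iff_iff]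
    change ω ∈ (fun ω => kthDist (Φ ω) k) ⁻¹' Set.Ioi r ↔
      ω ∈ {ω | pointCount Φ (Metric.closedBall 0 r) ω < k}
    simpa [pointCount] using not_congr this
  have hIic : generalizedGamma d (poissonRadius d lam) k (Set.Iic 0) = 0 := by
    have := ae_generalizedGamma_pos d (poissonRadius d lam) k
    rw [ae_iff] at this
    simpa [Set.Iic, not_lt] using this
  have : IsProbabilityMeasure (P.map fun ω => kthDist (Φ ω) k) :=
    Measure.isProbabilityMeasure_map hm.aemeasurable
  have : IsProbabilityMeasure (generalizedGamma d (poissonRadius d lam) k) := by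
    refine ⟨?_⟩
    rw [← Set.Iic_union_Ioi (a := (0 : ℝ)), measure_union (by simp) measurableSet_Ioi, hIic,
      generalizedGamma_Ioi hd hk hb le_rfl]
    simp [hd0, poissonTail_zero hk]
  refine Measure.ext_of_Iic _ _ fun r => ?_
  rcases lt_or_ge r 0 with hr | hr
  · rw [measure_mono_null (Set.Iic_subset_Iic.2 hr.le) hIic, Measure.map_apply hm measurableSet_Iic]
    have : (fun ω => kthDist (Φ ω) k) ⁻¹' Set.Iic r = ∅ :=
      Set.eq_empty_of_forall_notMem fun ω hω => ((kthDist_nonneg (Φ ω) k).trans hω).not_gt hr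
    rw [this, measure_empty]
  · rw [← Set.compl_Ioi, prob_compl_eq_one_sub measurableSet_Ioi,
      prob_compl_eq_one_sub measurableSet_Ioi, hIoi hr]

end Poisson

/-! ### Complex moments of positive random variables -/

/-- The random variable `X` has the complex moment `E[X ^ s] = m`, the expectation being absolutely
convergent. -/
structure HasMoment {Ω : Type*} [MeasurableSpace Ω] (P : Measure Ω) (X : Ω → ℝ) (s m : ℂ) : Prop where
  integrable : Integrable (fun ω => (X ω : ℂ) ^ s) P
  integral_eq : ∫ ω, (X ω : ℂ) ^ s ∂P = m

theorem Complex.ofReal_rpow_cpow {x : ℝ} (hx : 0 < x) (a : ℝ) (s : ℂ) :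
    ((x ^ a : ℝ) : ℂ) ^ s = (x : ℂ) ^ (a * s) := by
  have h1 : (x : ℂ) ≠ 0 := by exact_mod_cast hx.ne'
  have h2 : ((x ^ a : ℝ) : ℂ) ≠ 0 := by exact_mod_cast (Real.rpow_pos_of_pos hx a).ne'
  rw [Complex.cpow_def_of_ne_zero h1, Complex.cpow_def_of_ne_zero h2, ← Complex.ofReal_log hx.le,
    ← Complex.ofReal_log (by positivity), Real.log_rpow hx]
  push_cast
  ring_nf

section Moments

variable {Ω : Type*} [MeasurableSpace Ω] {P : Measure Ω} {X Y : Ω → ℝ} {s m m' : ℂ}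

theorem HasMoment.rpow {a : ℝ} (hX : ∀ᵐ ω ∂P, 0 < X ω) (h : HasMoment P X (a * s) m) :
    HasMoment P (fun ω => X ω ^ a) s m := by
  have e : (fun ω => (X ω : ℂ) ^ (a * s)) =ᵐ[P] fun ω => ((X ω ^ a : ℝ) : ℂ) ^ s := by
    filter_upwards [hX] with ω hω
    rw [Complex.ofReal_rpow_cpow hω]
  exact ⟨h.integrable.congr e, by rw [← integral_congr_ae e, h.integral_eq]⟩

theorem HasMoment.mul (hXY : IndepFun X Y P) (hX : ∀ᵐ ω ∂P, 0 < X ω) (hY : ∀ᵐ ω ∂P, 0 < Y ω)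
    (h : HasMoment P X s m) (h' : HasMoment P Y s m') :
    HasMoment P (fun ω => X ω * Y ω) s (m * m') := by
  have e : (fun ω => (X ω : ℂ) ^ s * (Y ω : ℂ) ^ s) =ᵐ[P] fun ω => ((X ω * Y ω : ℝ) : ℂ) ^ s := by
    filter_upwards [hX, hY] with ω hx hy
    rw [Complex.ofReal_mul, Complex.mul_cpow_ofReal_nonneg hx.le hy.le]
  have hi : IndepFun (fun ω => (X ω : ℂ) ^ s) (fun ω => (Y ω : ℂ) ^ s) P :=
    hXY.comp (φ := fun x : ℝ => (x : ℂ) ^ s) (ψ := fun x : ℝ => (x : ℂ) ^ s)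
      (by fun_prop) (by fun_prop)
  refine ⟨(hi.integrable_mul h.integrable h'.integrable).congr e, ?_⟩
  rw [← integral_congr_ae e, hi.integral_fun_mul_eq_mul_integral h.integrable.aestronglyMeasurable
    h'.integrable.aestronglyMeasurable, h.integral_eq, h'.integral_eq]

/-- The product of an atomless random variable and an independent positive one is atomless. -/
theorem measure_mul_eq_const_of_indepFun [IsProbabilityMeasure P] (hXm : Measurable X)
    (hYm : Measurable Y) (hXY : IndepFun X Y P) (hY : ∀ᵐ ω ∂P, 0 < Y ω)
    (hX : ∀ a, P {ω | X ω = a} = 0) (a : ℝ) : P {ω | X ω * Y ω = a} = 0 := by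
  have hA : MeasurableSet {p : ℝ × ℝ | p.1 * p.2 = a} :=
    measurableSet_eq_fun (by fun_prop) (by fun_prop)
  have h1 : P {ω | X ω * Y ω = a} =
      P.map (fun ω => (X ω, Y ω)) {p : ℝ × ℝ | p.1 * p.2 = a} := by
    rw [Measure.map_apply (hXm.prodMk hYm) hA]; rfl
  have : IsProbabilityMeasure (P.map X) := Measure.isProbabilityMeasure_map hXm.aemeasurable
  have : IsProbabilityMeasure (P.map Y) := Measure.isProbabilityMeasure_map hYm.aemeasurable
  rw [h1, (indepFun_iff_map_prod_eq_prod_map_map hXm.aemeasurable hYm.aemeasurable).1 hXY,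
    Measure.prod_apply_symm hA, lintegral_eq_zero_iff (measurable_measure_prodMk_right hA)]
  have hY' : ∀ᵐ y ∂P.map Y, 0 < y := (ae_map_iff hYm.aemeasurable measurableSet_Ioi).2 hY
  filter_upwards [hY'] with y hy
  refine measure_mono_null (t := {a / y}) ?_ ?_
  · intro x hx
    exact (eq_div_iff hy.ne').2 hx
  · rw [Measure.map_apply hXm (measurableSet_singleton _)]
    exact hX _

variable {q b k : ℝ}

theorem ae_pos_of_map_eq_generalizedGamma (hX : Measurable X)
    (h : P.map X = generalizedGamma q b k) : ∀ᵐ ω ∂P, 0 < X ω :=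
  ae_of_ae_map hX.aemeasurable (h ▸ ae_generalizedGamma_pos q b k)

theorem hasMoment_of_map_eq_generalizedGamma (hX : Measurable X)
    (h : P.map X = generalizedGamma q b k) (hq : 0 < q) (hb : 0 < b) (hk : 0 < k)
    (hs : 0 < q * k + s.re) :
    HasMoment P (fun ω => X ω / b) s (Complex.Gamma (k + s / q) / Complex.Gamma k) := by
  obtain ⟨h1, h2⟩ := generalizedGamma_moment hq hb hk hs
  rw [← h] at h1 h2
  refine ⟨h1.comp_measurable hX, ?_⟩
  rw [← h2, integral_map hX.aemeasurable h1.aestronglyMeasurable]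

theorem measure_eq_const_of_map_eq_generalizedGamma (hX : Measurable X)
    (h : P.map X = generalizedGamma q b k) (hb : 0 < b) (a : ℝ) : P {ω | X ω / b = a} = 0 := by
  have h1 : {ω | X ω / b = a} = X ⁻¹' {a * b} := by
    ext ω; simp [div_eq_iff hb.ne']
  rw [h1, ← Measure.map_apply hX (measurableSet_singleton _), h]
  exact generalizedGamma_absolutelyContinuous q b k (by simp)

end Moments

/-! ### The Fox function of the closed form -/

/-- The separating lines are those with `0 < c < min (αk μk / 2) δ`: the pole of `Γ(s)` at `0` is the
rightmost one on the left, since `μe` and `k` are nonnegative. -/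
theorem foxSeparates_NN_iff {αk μk αe μe δ : ℝ} {k : ℕ} (hαk : 0 < αk) (hαe : 0 < αe)
    (hμe : 0 < μe) (hδ : 0 < δ) (c : ℝ) :
    FoxSeparates 3 2 (upperNN αk μk δ) (lowerNN αe μe δ k) c ↔
      0 < c ∧ c < αk * μk / 2 ∧ c < δ := by
  simp only [FoxSeparates, upperNN, lowerNN, List.take, List.forall_mem_cons, List.not_mem_nil,
    IsEmpty.forall_iff, implies_true, and_true, Complex.ofReal_re, Complex.zero_re,
    Complex.natCast_re, zero_add, div_one, sub_zero, sub_sub_cancel]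
  constructor
  · rintro ⟨⟨h1, -, -⟩, h2, h3⟩
    have h1 := h1 0
    have h2 := h2 0
    have h3 := h3 0
    simp only [Nat.cast_zero, neg_zero, add_zero, one_div, inv_inv] at h1 h2 h3
    refine ⟨h1, ?_, by simpa using h3⟩
    rw [lt_div_iff₀ (by positivity)] at h2 ⊢
    rw [← mul_div_assoc, div_lt_iff₀ hαk] at h2
    linarith
  · rintro ⟨h1, h2, h3⟩
    refine ⟨⟨fun ν => ?_, fun ν => ?_, fun ν => ?_⟩, fun ν => ?_, fun ν => ?_⟩
    · exact lt_of_le_of_lt (by simp) h1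
    · refine lt_of_le_of_lt ?_ h1
      exact div_nonpos_of_nonpos_of_nonneg (by have := ν.cast_nonneg (α := ℝ); linarith)
        (by positivity)
    · refine lt_of_le_of_lt ?_ h1
      exact div_nonpos_of_nonpos_of_nonneg
        (by have := ν.cast_nonneg (α := ℝ); have := k.cast_nonneg (α := ℝ); linarith)
        (by positivity)
    · rw [lt_div_iff₀ (by positivity), ← mul_div_assoc, div_lt_iff₀ hαk]
      have : 0 ≤ αk * ν := by positivity
      nlinarith
    · rw [div_div_eq_mul_div, div_one]
      have : 0 ≤ ν * δ := by positivity
      linarith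

/-- To the right of `0` the quotient `Γ(s) / Γ(1 + s)` in the kernel is `1 / s`. -/
theorem foxKernel_NN_eq {αk μk αe μe δ : ℝ} {k : ℕ} {s : ℂ} (hs : 0 < s.re) :
    foxKernel 3 2 (upperNN αk μk δ) (lowerNN αe μe δ k) s =
      Complex.Gamma ((μe : ℝ) + (2 / αe : ℝ) * s) * Complex.Gamma ((μk : ℝ) + (-(2 / αk) : ℝ) * s) *
        Complex.Gamma ((k : ℝ) + (1 / δ : ℝ) * s) * Complex.Gamma ((1 : ℝ) + (-(1 / δ) : ℝ) * s) / s := by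
  have hs0 : s ≠ 0 := fun h => by simp [h] at hs
  have hG : Complex.Gamma s ≠ 0 := Complex.Gamma_ne_zero_of_re_pos hs
  simp only [foxKernel, upperNN, lowerNN, List.take, List.drop, List.map, List.prod_cons,
    List.prod_nil, Complex.ofReal_one, one_mul, mul_one, zero_add, sub_zero]
  rw [add_comm (1 : ℂ) s, Complex.Gamma_add_one s hs0]
  push_cast
  rw [show (1 : ℂ) - (1 - μk) - 2 / αk * s = μk + -(2 / αk) * s by ring,
    show (1 : ℂ) - 1 / δ * s = 1 + -(1 / δ) * s by ring]
  field_simp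

/-! ### The secrecy capacity -/

theorem mainTheorem5 {Ω : Type*} [MeasurableSpace Ω] (P : Measure Ω) [IsProbabilityMeasure P]
    (d : ℕ) (hd : 1 ≤ d) (k : ℕ) (hk : 1 ≤ k)
    (υ lamb lame : ℝ) (hυ : 0 < υ) (hlamb : 0 < lamb) (hlame : 0 < lame)
    (αk μk αe μe : ℝ) (hαk : 0 < αk) (hμk : 0 < μk) (hαe : 0 < αe) (hμe : 0 < μe)
    (p σk σe : ℝ) (hp : 0 < p) (hσk : 0 < σk) (hσe : 0 < σe)
    (Φb Φe : Ω → Set (EuclideanSpace ℝ (Fin d)))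
    (hΦb : IsHPPP P lamb Φb) (hΦe : IsHPPP P lame Φe)
    (gk ge : Ω → ℝ) (hgk : Measurable gk) (hge : Measurable ge)
    (hgk_law : P.map gk = gainLaw αk μk) (hge_law : P.map ge = gainLaw αe μe)
    (hindep : iIndep
      ![sigmaPoints Φb, sigmaPoints Φe,
        MeasurableSpace.comap gk inferInstance, MeasurableSpace.comap ge inferInstance] P)
    (ηk ηe ϖ δ : ℝ) (hηk : ηk = snrScale p σk) (hηe : ηe = snrScale p σe)
    (hϖ : ϖ = ηk / ηe) (hδ : δ = (d : ℝ) / υ) :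
    FoxHExists 3 2 (upperNN αk μk δ) (lowerNN αe μe δ k)
        ((argNN αk μk αe μe ϖ lamb lame δ : ℝ) : ℂ) ∧
      ((pnzNN P Φb Φe gk ge ηk ηe υ k : ℝ) : ℂ) =
        1 - ((gainEps αk μk * gainEps αe μe /
              (gainTheta αk μk * gainTheta αe μe * Real.Gamma k) : ℝ) : ℂ) *
          foxH 3 2 (upperNN αk μk δ) (lowerNN αe μe δ k)
            ((argNN αk μk αe μe ϖ lamb lame δ : ℝ) : ℂ) := by
  have hd0 : (0 : ℝ) < d := by exact_mod_cast hd
  have hk0 : (0 : ℝ) < k := by exact_mod_cast hk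
  have hδ0 : 0 < δ := by rw [hδ]; positivity
  have hηk0 : 0 < ηk := by rw [hηk, snrScale]; positivity
  have hηe0 : 0 < ηe := by rw [hηe, snrScale]; positivity
  have hϖ0 : 0 < ϖ := by rw [hϖ]; positivity
  have hΓk : 0 < Real.Gamma μk := Real.Gamma_pos_of_pos hμk
  have hΓe : 0 < Real.Gamma μe := Real.Gamma_pos_of_pos hμe
  have hΓn : 0 < Real.Gamma k := Real.Gamma_pos_of_pos hk0
  set Ωk := gainScale αk μk with hΩk
  set Ωe := gainScale αe μe with hΩe
  have hΩk0 : 0 < Ωk := div_pos hΓk (Real.Gamma_pos_of_pos (by positivity))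
  have hΩe0 : 0 < Ωe := div_pos hΓe (Real.Gamma_pos_of_pos (by positivity))
  rw [gainLaw_eq_generalizedGamma] at hgk_law hge_law
  set rk : Ω → ℝ := fun ω => kthDist (Φb ω) k
  set re : Ω → ℝ := fun ω => kthDist (Φe ω) 1
  have hrk : Measurable rk := hΦb.measurable_kthDist k
  have hre : Measurable re := hΦe.measurable_kthDist 1
  have hrk_law := hΦb.map_kthDist hd hlamb hk
  have hre_law := hΦe.map_kthDist hd hlame le_rfl
  set bk := poissonRadius d lamb with hbk
  set be := poissonRadius d lame with hbe
  have hbk0 : 0 < bk := poissonRadius_pos d hlamb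
  have hbe0 : 0 < be := poissonRadius_pos d hlame
  have hgk_pos := ae_pos_of_map_eq_generalizedGamma hgk hgk_law
  have hge_pos := ae_pos_of_map_eq_generalizedGamma hge hge_law
  have hrk_pos := ae_pos_of_map_eq_generalizedGamma hrk hrk_law
  have hre_pos := ae_pos_of_map_eq_generalizedGamma hre hre_law
  have hind : iIndepFun ![rk, re, gk, ge] P := by
    refine iIndep_of_iIndep_of_le hindep fun i => ?_
    fin_cases i
    · exact (measurable_kthDist hΦb.locallyFinite k).comap_le
    · exact (measurable_kthDist hΦe.locallyFinite 1).comap_le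
    · exact le_rfl
    · exact le_rfl
  have hmeas (i : Fin 4) : Measurable (![rk, re, gk, ge] i) := by
    fin_cases i <;> assumption
  -- the quotient of `g_e / r_e ^ υ` by `g_k / r_k ^ υ`, with all scales divided out, is `Y`
  set Ye : Ω → ℝ := fun ω => ge ω / Ωe with hYe
  set Yk : Ω → ℝ := fun ω => (gk ω / Ωk) ^ (-1 : ℝ) with hYk
  set Rk : Ω → ℝ := fun ω => (rk ω / bk) ^ υ with hRk
  set Re : Ω → ℝ := fun ω => (re ω / be) ^ (-υ) with hRe
  set Y : Ω → ℝ := fun ω => (Ye ω * Yk ω) * (Rk ω * Re ω) with hY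
  have hYem : Measurable Ye := by fun_prop
  have hYkm : Measurable Yk := by fun_prop
  have hRkm : Measurable Rk := by fun_prop
  have hRem : Measurable Re := by fun_prop
  have hYm : Measurable Y := by fun_prop
  have hYe_pos : ∀ᵐ ω ∂P, 0 < Ye ω := hge_pos.mono fun ω h => div_pos h hΩe0
  have hgk_pos' : ∀ᵐ ω ∂P, 0 < gk ω / Ωk := hgk_pos.mono fun ω h => div_pos h hΩk0
  have hrk_pos' : ∀ᵐ ω ∂P, 0 < rk ω / bk := hrk_pos.mono fun ω h => div_pos h hbk0
  have hre_pos' : ∀ᵐ ω ∂P, 0 < re ω / be := hre_pos.mono fun ω h => div_pos h hbe0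
  have hYk_pos : ∀ᵐ ω ∂P, 0 < Yk ω := hgk_pos'.mono fun ω h => Real.rpow_pos_of_pos h _
  have hRk_pos : ∀ᵐ ω ∂P, 0 < Rk ω := hrk_pos'.mono fun ω h => Real.rpow_pos_of_pos h _
  have hRe_pos : ∀ᵐ ω ∂P, 0 < Re ω := hre_pos'.mono fun ω h => Real.rpow_pos_of_pos h _
  have hG_pos : ∀ᵐ ω ∂P, 0 < Ye ω * Yk ω := by
    filter_upwards [hYe_pos, hYk_pos] with ω h h' using mul_pos h h'
  have hR_pos : ∀ᵐ ω ∂P, 0 < Rk ω * Re ω := by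
    filter_upwards [hRk_pos, hRe_pos] with ω h h' using mul_pos h h'
  have hY_pos : ∀ᵐ ω ∂P, 0 < Y ω := by
    filter_upwards [hG_pos, hR_pos] with ω h h' using mul_pos h h'
  have hindG : IndepFun Ye Yk P :=
    (hind.indepFun (i := 3) (j := 2) (by decide)).comp (φ := fun x : ℝ => x / Ωe)
      (ψ := fun x : ℝ => (x / Ωk) ^ (-1 : ℝ)) (by fun_prop) (by fun_prop)
  have hindR : IndepFun Rk Re P :=
    (hind.indepFun (i := 0) (j := 1) (by decide)).comp (φ := fun x : ℝ => (x / bk) ^ υ)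
      (ψ := fun x : ℝ => (x / be) ^ (-υ)) (by fun_prop) (by fun_prop)
  have hindY : IndepFun (fun ω => Ye ω * Yk ω) (fun ω => Rk ω * Re ω) P :=
    (hind.indepFun_prodMk_prodMk hmeas 3 2 0 1 (by decide) (by decide) (by decide) (by decide)).comp
      (φ := fun x : ℝ × ℝ => x.1 / Ωe * (x.2 / Ωk) ^ (-1 : ℝ))
      (ψ := fun x : ℝ × ℝ => (x.1 / bk) ^ υ * (x.2 / be) ^ (-υ)) (by fun_prop) (by fun_prop)
  have hatom (a : ℝ) : P {ω | Y ω = a} = 0 :=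
    measure_mul_eq_const_of_indepFun (hYem.mul hYkm) (hRkm.mul hRem) hindY hR_pos
      (measure_mul_eq_const_of_indepFun hYem hYkm hindG hYk_pos
        (measure_eq_const_of_map_eq_generalizedGamma hge hge_law hΩe0)) a
  set z := argNN αk μk αe μe ϖ lamb lame δ with hz
  have hz0 : 0 < z := by
    rw [hz, argNN, gainTheta, gainTheta, ← hΩk, ← hΩe]
    positivity
  have hνprob : IsProbabilityMeasure (P.map Y) := Measure.isProbabilityMeasure_map hYm.aemeasurable
  -- the secrecy capacity is non-zero precisely when `Y < z`
  have hpnz : pnzNN P Φb Φe gk ge ηk ηe υ k = 1 - (P.map Y).real (Set.Ioi z) := by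
    have hzeq : z = Ωk / Ωe * (ηk / ηe) * (be ^ υ / bk ^ υ) := by
      have hV := volume_real_unitBall_pos d
      set V := volume.real (Metric.ball (0 : EuclideanSpace ℝ (Fin d)) 1)
      have hrad {l : ℝ} (hl : 0 < l) : poissonRadius d l ^ υ = ((l * V) ^ (1 / δ))⁻¹ := by
        rw [poissonRadius, ← Real.rpow_mul (by positivity), ← Real.rpow_neg (by positivity), hδ]
        congr 1
        field_simp
      rw [hbk, hbe, hrad hlamb, hrad hlame, inv_div_inv, ← Real.div_rpow (by positivity)
        (by positivity), mul_div_mul_right _ _ hV.ne', hz, argNN,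
        mul_div_mul_left _ _ Real.pi_pos.ne', gainTheta, gainTheta, hϖ, ← hΩk,
        ← hΩe]
      field_simp
    have h1 : P.real {ω | Y ω ≤ z} = 1 - (P.map Y).real (Set.Ioi z) := by
      rw [map_measureReal_apply hYm measurableSet_Ioi,
        ← probReal_compl_eq_one_sub (hYm measurableSet_Ioi)]
      congr 1
      ext ω
      simp
    rw [← h1, pnzNN]
    refine measureReal_congr ?_
    have hne : ∀ᵐ ω ∂P, Y ω ≠ z := by
      rw [ae_iff]; simpa using hatom z
    filter_upwards [hgk_pos, hge_pos, hrk_pos, hre_pos, hne] with ω h1 h2 h3 h4 h5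
    rw [eq_iff_iff]
    change snr ηe (ge ω) (re ω) υ < snr ηk (gk ω) (rk ω) υ ↔ Y ω ≤ z
    rw [le_iff_lt_or_eq, or_iff_left h5]
    have hYval : Y ω = z * (snr ηe (ge ω) (re ω) υ / snr ηk (gk ω) (rk ω) υ) := by
      simp only [hY, hYe, hYk, hRk, hRe, snr]
      rw [hzeq, Real.rpow_neg_one, Real.rpow_neg (by positivity), Real.div_rpow h3.le hbk0.le,
        Real.div_rpow h4.le hbe0.le]
      have := Real.rpow_pos_of_pos h3 υ
      have := Real.rpow_pos_of_pos h4 υ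
      have := Real.rpow_pos_of_pos hbk0 υ
      have := Real.rpow_pos_of_pos hbe0 υ
      field_simp
    have hs : 0 < snr ηk (gk ω) (rk ω) υ := by
      have := Real.rpow_pos_of_pos h3 υ
      unfold snr; positivity
    rw [hYval, mul_lt_iff_lt_one_right hz0, div_lt_one hs]
  -- `E[Y ^ s]` is a product of four Gamma functions over `K`; the shape `1` of `re` adds `Γ(1) = 1`
  set K : ℂ := Complex.Gamma μe * Complex.Gamma μk * Complex.Gamma k with hK
  have hK' : K = ((Real.Gamma μe * Real.Gamma μk * Real.Gamma k : ℝ) : ℂ) := by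
    rw [hK, Complex.Gamma_ofReal, Complex.Gamma_ofReal]
    push_cast
    rw [← Complex.Gamma_ofReal k, Complex.ofReal_natCast]
  have hK0 : K ≠ 0 := by
    rw [hK']
    exact_mod_cast (by positivity : Real.Gamma μe * Real.Gamma μk * Real.Gamma k ≠ 0)
  have hfox : HasFoxH 3 2 (upperNN αk μk δ) (lowerNN αe μe δ k) (z : ℂ)
      (K * (P.map Y).real (Set.Ioi z)) := by
    refine ⟨⟨min (αk * μk / 2) δ / 2, ?_⟩, fun c hc => ?_⟩
    · -- the midpoint of the admissible interval
      have h : 0 < min (αk * μk / 2) δ := lt_min (by positivity) hδ0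
      refine (foxSeparates_NN_iff hαk hαe hμe hδ0 _).2 ⟨by linarith, ?_, ?_⟩
      · linarith [min_le_left (αk * μk / 2) δ]
      · linarith [min_le_right (αk * μk / 2) δ]
    obtain ⟨hc0, hck, hcδ⟩ := (foxSeparates_NN_iff hαk hαe hμe hδ0 c).1 hc
    have hcre (t : ℝ) : ((c : ℂ) + t * Complex.I).re = c := by simp
    have hposk : 0 < μk + -(2 / αk) * c := by
      have : 2 / αk * c < μk := by
        rw [div_mul_eq_mul_div, div_lt_iff₀ hαk]; linarith
      linarith
    set N : ℂ → ℂ := fun s => Complex.Gamma ((μe : ℝ) + (2 / αe : ℝ) * s) *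
      Complex.Gamma ((μk : ℝ) + (-(2 / αk) : ℝ) * s) * Complex.Gamma ((k : ℝ) + (1 / δ : ℝ) * s) *
        Complex.Gamma ((1 : ℝ) + (-(1 / δ) : ℝ) * s) with hN
    have hNint : Integrable fun t : ℝ => N (c + t * Complex.I) / (c + t * Complex.I) := by
      refine integrable_Gamma_prod_div hc0 (by positivity) ?_ (by positivity) ?_
        (neg_ne_zero.2 (by positivity))
      · exact hposk
      · rw [neg_mul, one_div_mul_eq_div, ← sub_eq_add_neg, sub_pos]
        exact (div_lt_one hδ0).2 hcδ
    have hF (t : ℝ) : foxIntegrand 3 2 (upperNN αk μk δ) (lowerNN αe μe δ k) z c t =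
        N (c + t * Complex.I) / (c + t * Complex.I) * (z : ℂ) ^ (-((c : ℂ) + t * Complex.I)) := by
      rw [foxIntegrand, foxKernel_NN_eq (by rw [hcre]; exact hc0)]
    have hmom (s : ℂ) (hs : s.re = c) : HasMoment P Y s (N s / K) := by
      have m1 : HasMoment P Ye s _ := hasMoment_of_map_eq_generalizedGamma (s := s) hge hge_law
        (by positivity) hΩe0 hμe (by rw [hs]; positivity)
      have m2 : HasMoment P Yk s _ := HasMoment.rpow hgk_pos'
        (hasMoment_of_map_eq_generalizedGamma (s := (-1 : ℝ) * s) hgk hgk_law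
          (by positivity) hΩk0 hμk (by rw [Complex.re_ofReal_mul, hs]; linarith))
      have m3 : HasMoment P Rk s _ := HasMoment.rpow hrk_pos'
        (hasMoment_of_map_eq_generalizedGamma (s := (υ : ℝ) * s) hrk hrk_law
          hd0 hbk0 hk0 (by rw [Complex.re_ofReal_mul, hs]; positivity))
      have m4 : HasMoment P Re s _ := HasMoment.rpow hre_pos'
        (hasMoment_of_map_eq_generalizedGamma (s := (-υ : ℝ) * s) hre hre_law
          hd0 hbe0 (by simp) (by
            rw [Complex.re_ofReal_mul, hs]
            rw [hδ, lt_div_iff₀ hυ] at hcδ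
            push_cast
            linarith))
      have m := (m1.mul hindG hYe_pos hYk_pos m2).mul hindY hG_pos hR_pos
        (m3.mul hindR hRk_pos hRe_pos m4)
      convert m using 1
      have hd' : (d : ℂ) ≠ 0 := by exact_mod_cast hd0.ne'
      have hυ' : (υ : ℂ) ≠ 0 := by exact_mod_cast hυ.ne'
      have e1 : ((μe : ℝ) : ℂ) + s / (αe / 2 : ℝ) = (μe : ℝ) + (2 / αe : ℝ) * s := by
        push_cast; field_simp
      have e2 : ((μk : ℝ) : ℂ) + (-1 : ℝ) * s / (αk / 2 : ℝ) = (μk : ℝ) + (-(2 / αk) : ℝ) * s := by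
        push_cast; field_simp
      have e3 : ((k : ℝ) : ℂ) + (υ : ℝ) * s / (d : ℝ) = (k : ℝ) + (1 / δ : ℝ) * s := by
        rw [hδ]; push_cast; field_simp
      have e4 : (((1 : ℕ) : ℝ) : ℂ) + (-υ : ℝ) * s / (d : ℝ) = (1 : ℝ) + (-(1 / δ) : ℝ) * s := by
        rw [hδ]; push_cast; field_simp
      rw [e1, e2, e3, e4, hN, hK]
      simp only [Nat.cast_one, Complex.ofReal_one, Complex.Gamma_one, div_one,
        Complex.ofReal_natCast]
      ring
    have hperron := measureReal_Ioi_eq_integral (μ := P.map Y) (M := fun s => N s / K)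
      ((ae_map_iff hYm.aemeasurable measurableSet_Ioi).2 hY_pos) hc0 hz0
      (by rw [Measure.map_apply hYm (measurableSet_singleton _)]; exact hatom z)
      (fun s hs => by
        obtain ⟨h1, h2⟩ := hmom s hs
        have hm : AEStronglyMeasurable (fun y : ℝ => (y : ℂ) ^ s) (P.map Y) :=
          Measurable.aestronglyMeasurable (by fun_prop)
        exact ⟨(integrable_map_measure hm hYm.aemeasurable).2 h1,
          by rw [integral_map hYm.aemeasurable hm, h2]⟩)
      ((hNint.div_const K).congr (Filter.Eventually.of_forall fun t => by ring))
    refine ⟨?_, ?_⟩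
    · have hzc : (z : ℂ) ≠ 0 := by exact_mod_cast hz0.ne'
      refine (hNint.mul_bdd (c := z ^ (-c)) (g := fun t : ℝ => (z : ℂ) ^ (-((c : ℂ) + t * Complex.I)))
        ?_ ?_).congr (Filter.Eventually.of_forall fun t => (hF t).symm)
      · exact Measurable.aestronglyMeasurable (by fun_prop)
      · refine Filter.Eventually.of_forall fun t => ?_
        rw [Complex.norm_cpow_eq_rpow_re_of_pos hz0, Complex.neg_re, hcre]
    · simp_rw [hF]
      rw [← hperron, mul_left_comm K, ← integral_const_mul K]
      congr 2
      funext t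
      field_simp
  refine ⟨⟨_, hfox⟩, ?_⟩
  rw [hfox.foxH_eq, hpnz, hK', ← Complex.ofReal_mul, ← Complex.ofReal_mul, ← Complex.ofReal_one,
    ← Complex.ofReal_sub]
  congr 2
  rw [gainEps, gainEps, gainTheta, gainTheta, ← hΩk, ← hΩe]
  field_simp
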